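/- **Nets.** Let $A_P, A_T$ be partially ordered sets with greatest elements (name spaces). A net $N=(P,T,pre,post,pl,tl,m)$ has sets $P,T$ of places and transitions, maps $pre,post:T\to P^\oplus$ into the free commutative monoid, labels $pl:P\to A_P$, $tl:T\to A_T$ and a marking $m\in P^\oplus$. A morphism $f:N_1\to N_2$ is a pair $f_P:P_1\to P_2$, $f_T:T_1\to T_2$ with $pre_2\circ f_T=f_P^\oplus\circ pre_1$, $post_2\circ f_T=f_P^\oplus\circ post_1$, $pl_2(f_P(p))\le pl_1(p)$, $tl_2(f_T(t))\le tl_1(t)$ and $m_1(p)\le m_2(f_P(p))$; it is strict if $f_P,f_T$ are injective and labels and markings are preserved exactly. A rule is a span $L\leftarrow K\to R$ of strict morphisms; a step $N\Rightarrow M$ via this rule at an occurrence $o:L\to N$ is a double pushout in the category of nets. For a transition $t$, $Net(t)$ is the net with the single transition $t$ and the places ${}^\bullet t\cup t^\bullet$, and $CP(t)$ is the net with these places and no transition (labels, arcs and marking restricted from $N$). **Hierarchical nets.** A reconfigurable net with substitutions consists of a net $N$ with local name spaces $A_P^N\subseteq A_P$, $A_T^N\subseteq A_T$ containing its labels; a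 set $sT\subseteq T$ of substitution transitions with reserved names $A_{sT}\subseteq A_T^N$, such that $tl(sT)\subseteq A_{sT}$, $tl|_{sT}$ is injective and $tl(T\setminus sT)\cap A_{sT}=\emptyset$; a set $A_{cP}\subseteq A_P^N$ containing the labels of all connecting places (the places in ${}^\bullet t\cup t^\bullet$, $t\in sT$); a set of local rules over $(A_P^N,A_T^N\setminus A_{sT})$; and, for each $t\in sT$, a substitution rule $subst(t)=(Net(t)\leftarrow CP(t)\to SN^t)$, where $CP(t)\to Net(t)$ is the inclusion, $CP(t)\to SN^t$ is strict, and $SN^t$ is again the underlying net of a reconfigurable net with substitutions (the nesting being well-founded) whose place name space contains $A_{cP}$. Two different connecting places of the same $t\in sT$ never agree simultaneously in name, marking, and the weights of their arcs to and from $t$. The names reserved for substitution transitions of one net of the hierarchy do not belong to the transition name space of any other net of the hierarchy. A hierarchical reconfigurable Petri net $HN$ is such a net $N$ with its hierarchy, together with a set of global rules. **Statement.** Let $SR$ be either the set of the substitution rules of the main net $N$ of $HN$, or the set of the substitution rules of all nets of the hierarchy. Write $HN\xRightarrow{sr!}F$ if $F$ is obtained from $N$ by finitely many steps via rules of $SR$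 at injective occurrences, in any order, and no rule of $SR$ can be applied to $F$ at an injective occurrence. Then $F$ is well-defined up to isomorphism: if $HN\xRightarrow{sr!}F$ and $HN\xRightarrow{sr!}\widehat F$, then $F\cong\widehat F$. Moreover, if $SR$ is finite, then there is no infinite sequence of such steps starting at $N$, and some $F$ with $HN\xRightarrow{sr!}F$ exists. -/

import Mathlib

open CategoryTheory

universe u v w

namespace HPN

/-- A marked labelled place/transition net over the name spaces `AP` (places) and `AT`
(transitions). The free commutative monoid `P^⊕` is `P →₀ ℕ`. -/
structure Net (AP : Type v) (AT : Type w) where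
  P : Type u
  T : Type u
  pre : T → P →₀ ℕ
  post : T → P →₀ ℕ
  pl : P → AP
  tl : T → AT
  mrk : P →₀ ℕ

section Category

variable {AP : Type v} {AT : Type w} [PartialOrder AP] [PartialOrder AT]

/-- Net morphisms: they preserve pre- and post-domains, may lower labels (subtyping) and may
increase the marking. -/
@[ext]
structure Net.Hom (N₁ N₂ : Net.{u} AP AT) where
  onP : N₁.P → N₂.P
  onT : N₁.T → N₂.T
  pre_eq : ∀ t, N₂.pre (onT t) = (N₁.pre t).mapDomain onP
  post_eq : ∀ t, N₂.post (onT t) = (N₁.post t).mapDomain onP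
  pl_le : ∀ p, N₂.pl (onP p) ≤ N₁.pl p
  tl_le : ∀ t, N₂.tl (onT t) ≤ N₁.tl t
  mrk_le : ∀ p, N₁.mrk p ≤ N₂.mrk (onP p)

/-- The category of place/transition nets with subtyping of labels. -/
instance : Category (Net.{u} AP AT) where
  Hom := Net.Hom
  id N :=
    { onP := id
      onT := id
      pre_eq := fun t => by simp
      post_eq := fun t => by simp
      pl_le := fun _ => le_rfl
      tl_le := fun _ => le_rfl
      mrk_le := fun _ => le_rfl }
  comp f g :=
    { onP := g.onP ∘ f.onP
      onT := g.onT ∘ f.onT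
      pre_eq := fun t => by simp [g.pre_eq, f.pre_eq, Finsupp.mapDomain_comp]
      post_eq := fun t => by simp [g.post_eq, f.post_eq, Finsupp.mapDomain_comp]
      pl_le := fun p => (g.pl_le _).trans (f.pl_le p)
      tl_le := fun t => (g.tl_le _).trans (f.tl_le t)
      mrk_le := fun p => (f.mrk_le p).trans (g.mrk_le _) }

/-- Injective net morphisms. -/
def Net.Hom.Inj {N₁ N₂ : Net.{u} AP AT} (f : N₁ ⟶ N₂) : Prop :=
  Function.Injective (Net.Hom.onP f) ∧ Function.Injective (Net.Hom.onT f)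

/-- Strict net morphisms: injective, preserving labels and markings. -/
def Net.Hom.Strict {N₁ N₂ : Net.{u} AP AT} (f : N₁ ⟶ N₂) : Prop :=
  Net.Hom.Inj f ∧
  (∀ t, N₂.tl (Net.Hom.onT f t) = N₁.tl t) ∧
  (∀ p, N₂.pl (Net.Hom.onP f p) = N₁.pl p) ∧
  (∀ p, N₁.mrk p = N₂.mrk (Net.Hom.onP f p))

variable (AP AT) in
/-- A rule `L ← K → R` is a span of strict morphisms. -/
structure Rule where
  L : Net.{u} AP AT
  K : Net.{u} AP AT
  R : Net.{u} AP AT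
  l : K ⟶ L
  r : K ⟶ R
  l_strict : Net.Hom.Strict l
  r_strict : Net.Hom.Strict r

/-- The transformation step `N ⇒ M` via `ρ` at the occurrence `o`: a double pushout. -/
def Rule.StepAt (ρ : Rule.{u} AP AT) {N : Net.{u} AP AT} (o : ρ.L ⟶ N)
    (M : Net.{u} AP AT) : Prop :=
  ∃ (D : Net.{u} AP AT) (k : ρ.K ⟶ D) (d : D ⟶ N) (n : ρ.R ⟶ M) (e : D ⟶ M),
    IsPushout ρ.l k o d ∧ IsPushout ρ.r k n e

/-- `N ⇒ M` via some rule of `SR` at some injective occurrence. -/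
def Step (SR : Set (Rule.{u} AP AT)) (N M : Net.{u} AP AT) : Prop :=
  ∃ ρ ∈ SR, ∃ o : ρ.L ⟶ N, Net.Hom.Inj o ∧ ρ.StepAt o M

/-- The transformation unit `N ⇒ F` (`sr!`): the rules of `SR` are applied, with injective
occurrences and in any order, as long as possible. -/
def TransUnit (SR : Set (Rule.{u} AP AT)) (N F : Net.{u} AP AT) : Prop :=
  Relation.ReflTransGen (Step SR) N F ∧ ∀ M, ¬ Step SR F M

end Category

section Substitution

variable {AP : Type v} {AT : Type w}

/-- `•t ∪ t•`. -/
def Net.nbhd (N : Net.{u} AP AT) (t : N.T) : Set N.P :=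
  {p | N.pre t p ≠ 0 ∨ N.post t p ≠ 0}

/-- `Net(t)`: the transition `t` with its adjacent places. -/
noncomputable def Net.netOf (N : Net.{u} AP AT) (t : N.T) : Net.{u} AP AT where
  P := {p // p ∈ N.nbhd t}
  T := {s // s = t}
  pre s := (N.pre s.1).subtypeDomain (· ∈ N.nbhd t)
  post s := (N.post s.1).subtypeDomain (· ∈ N.nbhd t)
  pl p := N.pl p.1
  tl s := N.tl s.1
  mrk := N.mrk.subtypeDomain (· ∈ N.nbhd t)

/-- `CP(t)`: the connecting places of `t`, without any transition. -/
noncomputable def Net.cp (N : Net.{u} AP AT) (t : N.T) : Net.{u} AP AT where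
  P := {p // p ∈ N.nbhd t}
  T := PEmpty
  pre s := s.elim
  post s := s.elim
  pl p := N.pl p.1
  tl s := s.elim
  mrk := N.mrk.subtypeDomain (· ∈ N.nbhd t)

/-- All labels of the net lie in the given sets of names. -/
def Net.Over (N : Net.{u} AP AT) (BP : Set AP) (BT : Set AT) : Prop :=
  (∀ p, N.pl p ∈ BP) ∧ ∀ t, N.tl t ∈ BT

variable [PartialOrder AP] [PartialOrder AT]

/-- The inclusion `CP(t) → Net(t)`. -/
noncomputable def Net.cpIncl (N : Net.{u} AP AT) (t : N.T) : N.cp t ⟶ N.netOf t where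
  onP := id
  onT s := s.elim
  pre_eq s := s.elim
  post_eq s := s.elim
  pl_le _ := le_rfl
  tl_le s := s.elim
  mrk_le _ := le_rfl

theorem Net.cpIncl_strict (N : Net.{u} AP AT) (t : N.T) : Net.Hom.Strict (N.cpIncl t) :=
  ⟨⟨fun _ _ h => h, fun s => s.elim⟩, fun s => s.elim, fun _ => rfl, fun _ => rfl⟩

/-- One level of a hierarchical net with underlying net `N`: local name spaces, local rules,
substitution transitions, and for every substitution transition `t` the subnet `SN t` together with
the embedding of the connecting places of `t` into it. -/
structure Level (N : Net.{u} AP AT) where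
  placeNames : Set AP
  transNames : Set AT
  labels_over : N.Over placeNames transNames
  /-- the substitution transitions -/
  sT : Set N.T
  /-- the names reserved for substitution transitions -/
  subNames : Set AT
  subNames_subset : subNames ⊆ transNames
  tl_sub : ∀ t ∈ sT, N.tl t ∈ subNames
  tl_inj : Set.InjOn N.tl sT
  tl_not_sub : ∀ t, t ∉ sT → N.tl t ∉ subNames
  /-- the names of connecting places -/
  connNames : Set AP
  connNames_subset : connNames ⊆ placeNames
  pl_conn : ∀ t ∈ sT, ∀ p ∈ N.nbhd t, N.pl p ∈ connNames
  /-- Different connecting places of one substitution transition are told apart by their names,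
  their markings or the weights of their arcs, that is, `Net(t)` has no automorphism but the
  identity. In particular this holds if they have different names. -/
  conn_distinct : ∀ t ∈ sT, ∀ p ∈ N.nbhd t, ∀ q ∈ N.nbhd t,
    N.pl p = N.pl q → N.mrk p = N.mrk q → N.pre t p = N.pre t q → N.post t p = N.post t q → p = q
  /-- the local rules -/
  rules : Set (Rule.{u} AP AT)
  rules_over : ∀ ρ ∈ rules, ρ.L.Over placeNames (transNames \ subNames) ∧
    ρ.K.Over placeNames (transNames \ subNames) ∧ ρ.R.Over placeNames (transNames \ subNames)
  SN : sT → Net.{u} AP AT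
  emb : ∀ t : sT, N.cp t.1 ⟶ SN t
  emb_strict : ∀ t, Net.Hom.Strict (emb t)

/-- `subst(t) = (Net(t) ← CP(t) → SN^t)`. -/
noncomputable def Level.subst {N : Net.{u} AP AT} (d : Level N) (t : d.sT) : Rule.{u} AP AT where
  L := N.netOf t.1
  K := N.cp t.1
  R := d.SN t
  l := N.cpIncl t.1
  r := d.emb t
  l_strict := N.cpIncl_strict t.1
  r_strict := d.emb_strict t

/-- Reconfigurable nets with substitutions: the subnets are reconfigurable nets with substitutions
again. -/
inductive SubstNet : Net.{u} AP AT → Type (max (u + 1) v w)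
  | mk (N : Net.{u} AP AT) (d : Level N) (sub : ∀ t : d.sT, SubstNet (d.SN t)) : SubstNet N

/-- The local name space of the places of the top level. -/
def SubstNet.placeNames : ∀ {N : Net.{u} AP AT}, SubstNet N → Set AP
  | _, .mk _ d _ => d.placeNames

/-- The union of the local transition name spaces of all levels. -/
def SubstNet.allTransNames : ∀ {N : Net.{u} AP AT}, SubstNet N → Set AT
  | _, .mk _ d sub => d.transNames ∪ ⋃ t, (sub t).allTransNames

/-- The union over all levels of the names reserved for substitution transitions. -/
def SubstNet.allSubNames : ∀ {N : Net.{u} AP AT}, SubstNet N → Set AT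
  | _, .mk _ d sub => d.subNames ∪ ⋃ t, (sub t).allSubNames

/-- Compatibility of the local name spaces: names of connecting places are known in the subnets,
and the names reserved for substitution transitions on one level do not belong to the transition
name space of any other one. The second part holds in particular if the local name spaces of the
levels are disjoint. -/
def SubstNet.WellNamed : ∀ {N : Net.{u} AP AT}, SubstNet N → Prop
  | _, .mk _ d sub =>
    (∀ t, d.connNames ⊆ (sub t).placeNames) ∧
    (∀ t, Disjoint d.subNames (sub t).allTransNames) ∧
    (∀ t, Disjoint d.transNames (sub t).allSubNames) ∧
    (∀ t t', t ≠ t' → Disjoint (sub t).allSubNames (sub t').allTransNames) ∧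
    ∀ t, (sub t).WellNamed

/-- The substitution rules `SR^N` of the main net. -/
def SubstNet.topRules : ∀ {N : Net.{u} AP AT}, SubstNet N → Set (Rule.{u} AP AT)
  | _, .mk _ d _ => Set.range d.subst

/-- The substitution rules of the main net and of all nested subnets. -/
def SubstNet.allRules : ∀ {N : Net.{u} AP AT}, SubstNet N → Set (Rule.{u} AP AT)
  | _, .mk _ d sub => Set.range d.subst ∪ ⋃ t, (sub t).allRules

variable (AP AT) in
/-- A hierarchical reconfigurable Petri net over the name space `(AP, AT)`. -/
structure HierNet where
  net : Net.{u} AP AT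
  subs : SubstNet net
  wellNamed : subs.WellNamed
  globalRules : Set (Rule.{u} AP AT)

end Substitution

end HPN

/-! A pushout of a strict morphism along an interface without transitions is a concrete gluing
(`IsGluing`, `IsGluing.of_isPushout`). For a substitution rule, all places of the left side lie in
the interface, so the pushout complement is the host net without the matched transition
(`Rule.IsSubst.isRemoval`). Hence an occurrence determines the result up to isomorphism
(`Rule.IsSubst.stepAt_unique`), and steps at different transitions commute (`Rule.IsSubst.diamond`).

It remains to see that a rule never has two competing occurrences. Pushouts preserve transition
names exactly, so an occurrence must hit a transition with the name of the rule. The invariant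
`Separated` makes this transition unique. Two injective occurrences there could differ only by
permuting connecting places, and `Rule.IsSubst.occurrence_unique` excludes this. Steps together with
isomorphisms are then confluent, and normal forms are unique by Church–Rosser.

For termination, assign to each name the set of names that its expansion may still replace. These
sets are disjoint for different transitions, and each step loses the name just expanded, so their
union shrinks strictly (`IsSystem.openNames_ssubset`); it is finite if the rules are. The naming
conditions of the hierarchy supply these sets in both cases, in `SubstNet.isSystem_topRules` and
`SubstNet.isSystem_allRules`. -/

namespace HPN

open Net.Hom

/-! ### Pushouts over an interface without transitions -/

section Gluing

variable {AP : Type v} {AT : Type w} [PartialOrder AP] [PartialOrder AT]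

theorem Net.hom_ext {M N : Net.{u} AP AT} {f g : M ⟶ N} (hP : ∀ p, onP f p = onP g p)
    (hT : ∀ t, onT f t = onT g t) : f = g :=
  Net.Hom.ext (funext hP) (funext hT)

@[simp] theorem Net.comp_onP {M N O : Net.{u} AP AT} (f : M ⟶ N) (g : N ⟶ O) (p : M.P) :
    onP (f ≫ g) p = onP g (onP f p) := rfl

@[simp] theorem Net.comp_onT {M N O : Net.{u} AP AT} (f : M ⟶ N) (g : N ⟶ O) (t : M.T) :
    onT (f ≫ g) t = onT g (onT f t) := rfl

theorem Net.congr_onP {M N : Net.{u} AP AT} {f g : M ⟶ N} (h : f = g) (p : M.P) :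
    onP f p = onP g p := by rw [h]

theorem Net.congr_onT {M N : Net.{u} AP AT} {f g : M ⟶ N} (h : f = g) (t : M.T) :
    onT f t = onT g t := by rw [h]

theorem Net.Hom.Strict.comp {M N O : Net.{u} AP AT} {f : M ⟶ N} {g : N ⟶ O}
    (hf : Strict f) (hg : Strict g) : Strict (f ≫ g) :=
  ⟨⟨hg.1.1.comp hf.1.1, hg.1.2.comp hf.1.2⟩,
    fun t => (hg.2.1 _).trans (hf.2.1 t), fun p => (hg.2.2.1 _).trans (hf.2.2.1 p),
    fun p => (hf.2.2.2 p).trans (hg.2.2.2 _)⟩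

theorem Net.iso_hom_inv_onP {M N : Net.{u} AP AT} (φ : M ≅ N) (p : M.P) :
    onP φ.inv (onP φ.hom p) = p := Net.congr_onP φ.hom_inv_id p

theorem Net.iso_hom_inv_onT {M N : Net.{u} AP AT} (φ : M ≅ N) (t : M.T) :
    onT φ.inv (onT φ.hom t) = t := Net.congr_onT φ.hom_inv_id t

/-- The inequalities for labels and markings hold for both the isomorphism and its inverse, so
antisymmetry turns them into equalities. -/
theorem Net.iso_strict {M N : Net.{u} AP AT} (φ : M ≅ N) : Strict φ.hom := by
  refine ⟨⟨fun p q h => ?_, fun s t h => ?_⟩, fun t => le_antisymm (φ.hom.tl_le t) ?_,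
    fun p => le_antisymm (φ.hom.pl_le p) ?_, fun p => le_antisymm (φ.hom.mrk_le p) ?_⟩
  · rw [← Net.iso_hom_inv_onP φ p, h, Net.iso_hom_inv_onP]
  · rw [← Net.iso_hom_inv_onT φ s, h, Net.iso_hom_inv_onT]
  · simpa only [Net.iso_hom_inv_onT] using φ.inv.tl_le (onT φ.hom t)
  · simpa only [Net.iso_hom_inv_onP] using φ.inv.pl_le (onP φ.hom p)
  · simpa only [Net.iso_hom_inv_onP] using φ.inv.mrk_le (onP φ.hom p)

/-- Concrete description of the pushout of a strict morphism `f` along `g`, where the common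
interface has no transitions. -/
structure IsGluing {K A B X : Net.{u} AP AT} (f : K ⟶ A) (g : K ⟶ B) (i : A ⟶ X) (j : B ⟶ X) :
    Prop where
  w : f ≫ i = g ≫ j
  cover_T : ∀ x, (∃ a, onT i a = x) ∨ ∃ b, onT j b = x
  cover_P : ∀ x, (∃ a, a ∉ Set.range (onP f) ∧ onP i a = x) ∨ ∃ b, onP j b = x
  inj_left_T : Function.Injective (onT i)
  inj_right_T : Function.Injective (onT j)
  disj_T : ∀ a b, onT i a ≠ onT j b
  inj_left_P : ∀ a a', a ∉ Set.range (onP f) → a' ∉ Set.range (onP f) →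
    onP i a = onP i a' → a = a'
  inj_right_P : Function.Injective (onP j)
  disj_P : ∀ a b, a ∉ Set.range (onP f) → onP i a ≠ onP j b
  tl_left : ∀ a, X.tl (onT i a) = A.tl a
  tl_right : ∀ b, X.tl (onT j b) = B.tl b
  pl_left : ∀ a, a ∉ Set.range (onP f) → X.pl (onP i a) = A.pl a
  pl_right : ∀ b, X.pl (onP j b) = B.pl b
  mrk_left : ∀ a, a ∉ Set.range (onP f) → A.mrk a = X.mrk (onP i a)
  mrk_right : ∀ b, B.mrk b = X.mrk (onP j b)

variable {K A B X : Net.{u} AP AT} {f : K ⟶ A} {g : K ⟶ B} {i : A ⟶ X} {j : B ⟶ X}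

theorem IsGluing.strict_right (h : IsGluing f g i j) : Strict j :=
  ⟨⟨h.inj_right_P, h.inj_right_T⟩, h.tl_right, h.pl_right, h.mrk_right⟩

theorem IsGluing.strict_left (h : IsGluing f g i j) (hf : Strict f) (hg : Strict g) :
    Strict i := by
  have hw : ∀ k, onP i (onP f k) = onP j (onP g k) := Net.congr_onP h.w
  refine ⟨⟨fun a a' e => ?_, h.inj_left_T⟩, h.tl_left, fun a => ?_, fun a => ?_⟩
  · by_cases ha : a ∈ Set.range (onP f) <;> by_cases ha' : a' ∈ Set.range (onP f)
    · obtain ⟨k, rfl⟩ := ha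
      obtain ⟨k', rfl⟩ := ha'
      rw [hw, hw] at e
      rw [hg.1.1 (h.inj_right_P e)]
    · obtain ⟨k, rfl⟩ := ha
      rw [hw] at e
      exact (h.disj_P _ _ ha' e.symm).elim
    · obtain ⟨k, rfl⟩ := ha'
      rw [hw] at e
      exact (h.disj_P _ _ ha e).elim
    · exact h.inj_left_P _ _ ha ha' e
  · by_cases ha : a ∈ Set.range (onP f)
    · obtain ⟨k, rfl⟩ := ha
      rw [hw, h.pl_right, hg.2.2.1, hf.2.2.1]
    · exact h.pl_left a ha
  · by_cases ha : a ∈ Set.range (onP f)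
    · obtain ⟨k, rfl⟩ := ha
      rw [hw, ← h.mrk_right, ← hg.2.2.2, hf.2.2.2]
    · exact h.mrk_left a ha

/-- The two parts overlap only in interface places, where `hab` makes the prescribed values agree.
Every element of `X` inherits its label and marking from a part that covers it, which yields the
inequalities. -/
theorem IsGluing.exists_desc (h : IsGluing f g i j) {Y : Net.{u} AP AT} (a : A ⟶ Y) (b : B ⟶ Y)
    (hab : f ≫ a = g ≫ b) : ∃ d : X ⟶ Y, i ≫ d = a ∧ j ≫ d = b := by
  have hw : ∀ k, onP i (onP f k) = onP j (onP g k) := Net.congr_onP h.w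
  have hY : ∀ k, onP a (onP f k) = onP b (onP g k) := Net.congr_onP hab
  have exP : ∀ x : X.P, ∃ y : Y.P, (∀ p, onP i p = x → y = onP a p) ∧
      ∀ p, onP j p = x → y = onP b p := by
    intro x
    rcases h.cover_P x with ⟨p, hp, rfl⟩ | ⟨p, rfl⟩
    · refine ⟨onP a p, fun q hq => ?_, fun q hq => (h.disj_P _ _ hp hq.symm).elim⟩
      by_cases hq' : q ∈ Set.range (onP f)
      · obtain ⟨k, rfl⟩ := hq'
        rw [hw] at hq
        exact (h.disj_P _ _ hp hq.symm).elim
      · rw [h.inj_left_P _ _ hq' hp hq]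
    · refine ⟨onP b p, fun q hq => ?_, fun q hq => by rw [h.inj_right_P hq]⟩
      by_cases hq' : q ∈ Set.range (onP f)
      · obtain ⟨k, rfl⟩ := hq'
        rw [hw] at hq
        rw [hY, h.inj_right_P hq]
      · exact (h.disj_P _ _ hq' hq).elim
  have exT : ∀ x : X.T, ∃ y : Y.T, (∀ p, onT i p = x → y = onT a p) ∧
      ∀ p, onT j p = x → y = onT b p := by
    intro x
    rcases h.cover_T x with ⟨p, rfl⟩ | ⟨p, rfl⟩
    · exact ⟨onT a p, fun q hq => by rw [h.inj_left_T hq],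
        fun q hq => (h.disj_T _ _ hq.symm).elim⟩
    · exact ⟨onT b p, fun q hq => (h.disj_T _ _ hq).elim,
        fun q hq => by rw [h.inj_right_T hq]⟩
  choose dP hPi hPj using exP
  choose dT hTi hTj using exT
  have hPi' : ∀ p, dP (onP i p) = onP a p := fun p => hPi _ p rfl
  have hPj' : ∀ p, dP (onP j p) = onP b p := fun p => hPj _ p rfl
  have hTi' : ∀ p, dT (onT i p) = onT a p := fun p => hTi _ p rfl
  have hTj' : ∀ p, dT (onT j p) = onT b p := fun p => hTj _ p rfl
  have ei : dP ∘ onP i = onP a := funext hPi'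
  have ej : dP ∘ onP j = onP b := funext hPj'
  refine ⟨{ onP := dP, onT := dT, pre_eq := ?_, post_eq := ?_, pl_le := ?_, tl_le := ?_,
            mrk_le := ?_ }, Net.hom_ext hPi' hTi', Net.hom_ext hPj' hTj'⟩
  · intro x
    rcases h.cover_T x with ⟨p, rfl⟩ | ⟨p, rfl⟩
    · rw [hTi', a.pre_eq, i.pre_eq, ← Finsupp.mapDomain_comp, ei]
    · rw [hTj', b.pre_eq, j.pre_eq, ← Finsupp.mapDomain_comp, ej]
  · intro x
    rcases h.cover_T x with ⟨p, rfl⟩ | ⟨p, rfl⟩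
    · rw [hTi', a.post_eq, i.post_eq, ← Finsupp.mapDomain_comp, ei]
    · rw [hTj', b.post_eq, j.post_eq, ← Finsupp.mapDomain_comp, ej]
  · intro x
    rcases h.cover_P x with ⟨p, hp, rfl⟩ | ⟨p, rfl⟩
    · rw [hPi', h.pl_left p hp]
      exact a.pl_le p
    · rw [hPj', h.pl_right p]
      exact b.pl_le p
  · intro x
    rcases h.cover_T x with ⟨p, rfl⟩ | ⟨p, rfl⟩
    · rw [hTi', h.tl_left p]
      exact a.tl_le p
    · rw [hTj', h.tl_right p]
      exact b.tl_le p
  · intro x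
    rcases h.cover_P x with ⟨p, hp, rfl⟩ | ⟨p, rfl⟩
    · rw [hPi', ← h.mrk_left p hp]
      exact a.mrk_le p
    · rw [hPj', ← h.mrk_right p]
      exact b.mrk_le p

theorem IsGluing.hom_ext (h : IsGluing f g i j) {Y : Net.{u} AP AT} {d d' : X ⟶ Y}
    (hi : i ≫ d = i ≫ d') (hj : j ≫ d = j ≫ d') : d = d' := by
  refine Net.hom_ext (fun x => ?_) (fun x => ?_)
  · rcases h.cover_P x with ⟨p, -, rfl⟩ | ⟨p, rfl⟩
    · exact Net.congr_onP hi p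
    · exact Net.congr_onP hj p
  · rcases h.cover_T x with ⟨p, rfl⟩ | ⟨p, rfl⟩
    · exact Net.congr_onT hi p
    · exact Net.congr_onT hj p

theorem IsGluing.isPushout (h : IsGluing f g i j) : IsPushout f g i j := by
  choose d hi hj using fun (s : Limits.PushoutCocone f g) =>
    h.exists_desc s.inl s.inr s.condition
  exact ⟨⟨h.w⟩, ⟨Limits.PushoutCocone.IsColimit.mk h.w d hi hj
    fun s m hmi hmj => h.hom_ext (hmi.trans (hi s).symm) (hmj.trans (hj s).symm)⟩⟩

theorem IsGluing.comp_iso (h : IsGluing f g i j) {Y : Net.{u} AP AT} (φ : X ≅ Y) :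
    IsGluing f g (i ≫ φ.hom) (j ≫ φ.hom) := by
  have hs := Net.iso_strict φ
  have surjP : ∀ y, onP φ.hom (onP φ.inv y) = y := Net.iso_hom_inv_onP φ.symm
  have surjT : ∀ y, onT φ.hom (onT φ.inv y) = y := Net.iso_hom_inv_onT φ.symm
  refine ⟨by rw [← Category.assoc, h.w, Category.assoc], fun x => ?_, fun x => ?_,
    hs.1.2.comp h.inj_left_T, hs.1.2.comp h.inj_right_T,
    fun a b e => h.disj_T a b (hs.1.2 e), fun a a' ha ha' e => h.inj_left_P a a' ha ha' (hs.1.1 e),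
    hs.1.1.comp h.inj_right_P, fun a b ha e => h.disj_P a b ha (hs.1.1 e),
    fun a => (hs.2.1 _).trans (h.tl_left a), fun a => (hs.2.1 _).trans (h.tl_right a),
    fun a ha => (hs.2.2.1 _).trans (h.pl_left a ha), fun a => (hs.2.2.1 _).trans (h.pl_right a),
    fun a ha => (h.mrk_left a ha).trans (hs.2.2.2 _),
    fun a => (h.mrk_right a).trans (hs.2.2.2 _)⟩
  · rcases h.cover_T (onT φ.inv x) with ⟨p, hp⟩ | ⟨p, hp⟩
    · exact Or.inl ⟨p, by rw [Net.comp_onT, hp, surjT]⟩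
    · exact Or.inr ⟨p, by rw [Net.comp_onT, hp, surjT]⟩
  · rcases h.cover_P (onP φ.inv x) with ⟨p, hp', hp⟩ | ⟨p, hp⟩
    · exact Or.inl ⟨p, hp', by rw [Net.comp_onP, hp, surjP]⟩
    · exact Or.inr ⟨p, by rw [Net.comp_onP, hp, surjP]⟩

open Classical in
/-- The places of `A` in the gluing of `A` and `B`. -/
noncomputable def gluingMap (f : K ⟶ A) (g : K ⟶ B) (p : A.P) :
    B.P ⊕ {p : A.P // p ∉ Set.range (onP f)} :=
  if h : p ∈ Set.range (onP f) then Sum.inl (onP g h.choose) else Sum.inr ⟨p, h⟩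

theorem gluingMap_apply (hf : Function.Injective (onP f)) (k : K.P) :
    gluingMap f g (onP f k) = Sum.inl (onP g k) := by
  have h : onP f k ∈ Set.range (onP f) := ⟨k, rfl⟩
  rw [gluingMap, dif_pos h, hf h.choose_spec]

theorem gluingMap_of_notMem {p : A.P} (h : p ∉ Set.range (onP f)) :
    gluingMap f g p = Sum.inr ⟨p, h⟩ := by
  rw [gluingMap, dif_neg h]

/-- The gluing of `A` and `B` along the places of `K`. -/
noncomputable def gluing (f : K ⟶ A) (g : K ⟶ B) : Net.{u} AP AT where
  P := B.P ⊕ {p : A.P // p ∉ Set.range (onP f)}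
  T := A.T ⊕ B.T
  pre := Sum.elim (fun t => (A.pre t).mapDomain (gluingMap f g))
    fun t => (B.pre t).mapDomain Sum.inl
  post := Sum.elim (fun t => (A.post t).mapDomain (gluingMap f g))
    fun t => (B.post t).mapDomain Sum.inl
  pl := Sum.elim B.pl fun p => A.pl p.1
  tl := Sum.elim A.tl B.tl
  mrk := Finsupp.sumElim B.mrk (A.mrk.subtypeDomain _)

/-- Interface places take label and marking from `B`. As `f` is strict and `g` may only lower labels
and raise markings, the map from `A` is still a morphism, so `g` need not be strict. -/
theorem exists_isGluing (hK : IsEmpty K.T) (hf : Strict f) (g : K ⟶ B) :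
    ∃ (X : Net.{u} AP AT) (i : A ⟶ X) (j : B ⟶ X), IsGluing f g i j := by
  let i : A ⟶ gluing f g :=
    { onP := gluingMap f g
      onT := Sum.inl
      pre_eq := fun _ => rfl
      post_eq := fun _ => rfl
      pl_le := fun p => by
        by_cases h : p ∈ Set.range (onP f)
        · obtain ⟨k, rfl⟩ := h
          rw [gluingMap_apply hf.1.1, hf.2.2.1]
          exact g.pl_le k
        · rw [gluingMap_of_notMem h]
          exact le_rfl
      tl_le := fun _ => le_rfl
      mrk_le := fun p => by
        by_cases h : p ∈ Set.range (onP f)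
        · obtain ⟨k, rfl⟩ := h
          rw [gluingMap_apply hf.1.1, ← hf.2.2.2]
          exact g.mrk_le k
        · rw [gluingMap_of_notMem h]
          exact le_rfl }
  let j : B ⟶ gluing f g :=
    { onP := Sum.inl
      onT := Sum.inr
      pre_eq := fun _ => rfl
      post_eq := fun _ => rfl
      pl_le := fun _ => le_rfl
      tl_le := fun _ => le_rfl
      mrk_le := fun _ => le_rfl }
  have hi : ∀ {p : A.P} (h : p ∉ Set.range (onP f)), onP i p = Sum.inr ⟨p, h⟩ :=
    fun h => gluingMap_of_notMem h
  refine ⟨gluing f g, i, j, Net.hom_ext (gluingMap_apply hf.1.1) hK.elim, ?_, ?_,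
    Sum.inl_injective, Sum.inr_injective, fun a b => Sum.inl_ne_inr, ?_, Sum.inl_injective, ?_,
    fun _ => rfl, fun _ => rfl, ?_, fun _ => rfl, ?_, fun _ => rfl⟩
  · rintro (t | t)
    · exact Or.inl ⟨t, rfl⟩
    · exact Or.inr ⟨t, rfl⟩
  · rintro (p | p)
    · exact Or.inr ⟨p, rfl⟩
    · exact Or.inl ⟨p.1, p.2, hi p.2⟩
  · intro a a' ha ha' e
    rw [hi ha, hi ha'] at e
    exact congrArg Subtype.val (Sum.inr_injective e)
  · intro a b ha e
    rw [hi ha] at e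
    exact Sum.inr_ne_inl e
  · intro a ha
    rw [hi ha]
    rfl
  · intro a ha
    rw [hi ha]
    rfl

/-- Any pushout is isomorphic to the constructed gluing, and the gluing conditions are invariant
under isomorphism. -/
theorem IsGluing.of_isPushout (h : IsPushout f g i j) (hK : IsEmpty K.T) (hf : Strict f) :
    IsGluing f g i j := by
  obtain ⟨X', i', j', h'⟩ := exists_isGluing hK hf g
  have := h'.comp_iso (h'.isPushout.isoIsPushout _ _ h)
  rwa [IsPushout.inl_isoIsPushout_hom, IsPushout.inr_isoIsPushout_hom] at this

end Gluing

/-! ### Pushout complements and uniqueness of occurrences -/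

section Removal

variable {AP : Type v} {AT : Type w} [PartialOrder AP] [PartialOrder AT]

theorem Net.Hom.Inj.cancel {X M N : Net.{u} AP AT} {d : M ⟶ N} (hd : Inj d) {f g : X ⟶ M}
    (h : f ≫ d = g ≫ d) : f = g :=
  Net.hom_ext (fun p => hd.1 (Net.congr_onP h p)) fun t => hd.2 (Net.congr_onT h t)

theorem Net.Hom.Inj.of_comp {X M N : Net.{u} AP AT} {f : X ⟶ M} {d : M ⟶ N} (h : Inj (f ≫ d)) :
    Inj f :=
  ⟨fun _ _ e => h.1 (congrArg (onP d) e), fun _ _ e => h.2 (congrArg (onT d) e)⟩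

theorem Net.Hom.Strict.of_comp {X M N : Net.{u} AP AT} {f : X ⟶ M} {d : M ⟶ N}
    (h : Strict (f ≫ d)) (hd : Strict d) : Strict f :=
  ⟨h.1.of_comp, fun t => (hd.2.1 _).symm.trans (h.2.1 t),
    fun p => (hd.2.2.1 _).symm.trans (h.2.2.1 p), fun p => (h.2.2.2 p).trans (hd.2.2.2 _).symm⟩

/-- `d : D ⟶ M` embeds `D` as the net `M` without the transition `s`. -/
structure IsRemoval {D M : Net.{u} AP AT} (s : M.T) (d : D ⟶ M) : Prop where
  strict : Strict d
  surj : Function.Surjective (onP d)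
  range : ∀ x, x ∈ Set.range (onT d) ↔ x ≠ s

theorem exists_isRemoval (M : Net.{u} AP AT) (s : M.T) :
    ∃ (D : Net.{u} AP AT) (d : D ⟶ M), IsRemoval s d := by
  let D : Net.{u} AP AT :=
    { P := M.P
      T := {x // x ≠ s}
      pre := fun x => M.pre x.1
      post := fun x => M.post x.1
      pl := M.pl
      tl := fun x => M.tl x.1
      mrk := M.mrk }
  let d : D ⟶ M :=
    { onP := id
      onT := Subtype.val
      pre_eq := fun _ => Finsupp.mapDomain_id.symm
      post_eq := fun _ => Finsupp.mapDomain_id.symm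
      pl_le := fun _ => le_rfl
      tl_le := fun _ => le_rfl
      mrk_le := fun _ => le_rfl }
  refine ⟨D, d, ⟨⟨Function.injective_id, Subtype.val_injective⟩, fun _ => rfl, fun _ => rfl,
    fun _ => rfl⟩, Function.surjective_id, fun x => ⟨?_, fun hx => ⟨⟨x, hx⟩, rfl⟩⟩⟩
  rintro ⟨y, rfl⟩
  exact y.2

theorem IsRemoval.exists_lift {D M X : Net.{u} AP AT} {s : M.T} {d : D ⟶ M} (h : IsRemoval s d)
    (f : X ⟶ M) (hf : ∀ x, onT f x ≠ s) : ∃ f' : X ⟶ D, f' ≫ d = f := by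
  choose fP hP using fun p => h.surj (onP f p)
  choose fT hT using fun x => (h.range _).2 (hf x)
  have e : onP d ∘ fP = onP f := funext hP
  refine ⟨{ onP := fP, onT := fT, pre_eq := fun t => ?_, post_eq := fun t => ?_,
            pl_le := fun p => ?_, tl_le := fun t => ?_, mrk_le := fun p => ?_ },
    Net.hom_ext hP hT⟩
  · apply Finsupp.mapDomain_injective h.strict.1.1
    rw [← Finsupp.mapDomain_comp, e, ← d.pre_eq, hT, f.pre_eq]
  · apply Finsupp.mapDomain_injective h.strict.1.1
    rw [← Finsupp.mapDomain_comp, e, ← d.post_eq, hT, f.post_eq]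
  · rw [← h.strict.2.2.1, hP]
    exact f.pl_le p
  · rw [← h.strict.2.1, hT]
    exact f.tl_le t
  · rw [h.strict.2.2.2, hP]
    exact f.mrk_le p

theorem IsRemoval.exists_iso {D D' M : Net.{u} AP AT} {s : M.T} {d : D ⟶ M} {d' : D' ⟶ M}
    (h : IsRemoval s d) (h' : IsRemoval s d') : ∃ φ : D ≅ D', φ.hom ≫ d' = d := by
  obtain ⟨a, ha⟩ := h'.exists_lift d fun x => (h.range _).1 ⟨x, rfl⟩
  obtain ⟨b, hb⟩ := h.exists_lift d' fun x => (h'.range _).1 ⟨x, rfl⟩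
  exact ⟨⟨a, b, h.strict.1.cancel (by rw [Category.assoc, hb, ha, Category.id_comp]),
    h'.strict.1.cancel (by rw [Category.assoc, ha, hb, Category.id_comp])⟩, ha⟩

/-- Rules which replace a single transition together with its adjacent places, where these places
are kept and can be told apart. -/
structure Rule.IsSubst (ρ : Rule.{u} AP AT) : Prop where
  isEmpty_K : IsEmpty ρ.K.T
  nonempty : Nonempty ρ.L.T
  subsingleton : Subsingleton ρ.L.T
  surj : Function.Surjective (onP ρ.l)
  adj : ∀ t p, ρ.L.pre t p ≠ 0 ∨ ρ.L.post t p ≠ 0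
  distinct : ∀ t p q, ρ.L.pl p = ρ.L.pl q → ρ.L.mrk p = ρ.L.mrk q →
    ρ.L.pre t p = ρ.L.pre t q → ρ.L.post t p = ρ.L.post t q → p = q

variable {ρ : Rule.{u} AP AT} {M D : Net.{u} AP AT} {k : ρ.K ⟶ D} {o : ρ.L ⟶ M} {d : D ⟶ M}

/-- Although a morphism may lower names, the left square being a pushout forbids it on transitions.
This is how names locate occurrences. -/
theorem Rule.IsSubst.tl_eq (hρ : ρ.IsSubst) (h : IsPushout ρ.l k o d) (t : ρ.L.T) :
    M.tl (onT o t) = ρ.L.tl t :=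
  (IsGluing.of_isPushout h hρ.isEmpty_K ρ.l_strict).tl_left t

theorem Rule.IsSubst.isRemoval (hρ : ρ.IsSubst) (h : IsPushout ρ.l k o d) (t : ρ.L.T) :
    IsRemoval (onT o t) d := by
  have hg := IsGluing.of_isPushout h hρ.isEmpty_K ρ.l_strict
  refine ⟨hg.strict_right, fun p => ?_, fun x => ⟨?_, fun hx => ?_⟩⟩
  · rcases hg.cover_P p with ⟨a, ha, -⟩ | hb
    · exact (ha (hρ.surj a)).elim
    · exact hb
  · rintro ⟨y, rfl⟩ e
    exact hg.disj_T _ _ e.symm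
  · rcases hg.cover_T x with ⟨a, rfl⟩ | hb
    · exact (hx (by rw [hρ.subsingleton.elim a t])).elim
    · exact hb

/-- Converse of `Rule.IsSubst.isRemoval`. The hypothesis `htl` is needed since `o` might lower the
name of the transition, and then the square is no pushout. -/
theorem Rule.IsSubst.isPushout_of_isRemoval (hρ : ρ.IsSubst) (w : ρ.l ≫ o = k ≫ d) (t : ρ.L.T)
    (h : IsRemoval (onT o t) d) (htl : M.tl (onT o t) = ρ.L.tl t) : IsPushout ρ.l k o d := by
  have hr : ∀ a, a ∈ Set.range (onP ρ.l) := hρ.surj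
  have hT : ∀ a, a = t := fun a => hρ.subsingleton.elim a t
  refine IsGluing.isPushout ⟨w, fun x => ?_, fun x => Or.inr (h.surj x),
    fun a b _ => hρ.subsingleton.elim a b, h.strict.1.2, fun a b e => ?_,
    fun a _ ha => (ha (hr a)).elim, h.strict.1.1, fun a _ ha => (ha (hr a)).elim,
    fun a => ?_, h.strict.2.1, fun a ha => (ha (hr a)).elim, h.strict.2.2.1,
    fun a ha => (ha (hr a)).elim, h.strict.2.2.2⟩
  · by_cases hx : x = onT o t
    · exact Or.inl ⟨t, hx.symm⟩
    · exact Or.inr ((h.range x).2 hx)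
  · rw [hT a] at e
    exact (h.range _).1 ⟨b, rfl⟩ e.symm
  · rw [hT a, htl]

theorem Rule.IsSubst.stepAt_unique (hρ : ρ.IsSubst) {M₁ M₂ : Net.{u} AP AT}
    (h₁ : ρ.StepAt o M₁) (h₂ : ρ.StepAt o M₂) : Nonempty (M₁ ≅ M₂) := by
  obtain ⟨t⟩ := hρ.nonempty
  obtain ⟨D₁, k₁, d₁, n₁, e₁, p₁, q₁⟩ := h₁
  obtain ⟨D₂, k₂, d₂, n₂, e₂, p₂, q₂⟩ := h₂
  obtain ⟨φ, hφ⟩ := (hρ.isRemoval p₁ t).exists_iso (hρ.isRemoval p₂ t)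
  have hk : k₁ ≫ φ.hom = k₂ := by
    apply (hρ.isRemoval p₂ t).strict.1.cancel
    rw [Category.assoc, hφ, ← p₁.w, p₂.w]
  have q : IsPushout ρ.r k₁ n₂ (φ.hom ≫ e₂) :=
    q₂.of_iso (Iso.refl _) (Iso.refl _) φ.symm (Iso.refl _) (by simp)
      (by simp [← hk]) (by simp) (by simp)
  exact ⟨q₁.isoIsPushout _ _ q⟩

/-- An injective occurrence is determined by the image of the transition if there is a strict one. -/
theorem Rule.IsSubst.occurrence_unique (hρ : ρ.IsSubst) {c : ρ.L ⟶ M} (hc : Strict c) (ho : Inj o)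
    (t : ρ.L.T) (h : onT o t = onT c t) : o = c := by
  have : Finite ρ.L.P := by
    classical
    refine Set.finite_univ_iff.1
      (((ρ.L.pre t).support ∪ (ρ.L.post t).support).finite_toSet.subset fun p _ => ?_)
    simpa using hρ.adj t p
  have hpre : (ρ.L.pre t).mapDomain (onP o) = (ρ.L.pre t).mapDomain (onP c) := by
    rw [← o.pre_eq, ← c.pre_eq, h]
  have hpost : (ρ.L.post t).mapDomain (onP o) = (ρ.L.post t).mapDomain (onP c) := by
    rw [← o.post_eq, ← c.post_eq, h]
  -- Both images are the set of places adjacent to the same transition, so `o` is `c` after an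
  -- injective self-map `π` of the places of `L`.
  have hex : ∀ p, onP o p ∈ Set.range (onP c) := by
    intro p
    by_contra hp
    have h1 := DFunLike.congr_fun hpre (onP o p)
    have h2 := DFunLike.congr_fun hpost (onP o p)
    rw [Finsupp.mapDomain_apply ho.1, Finsupp.mapDomain_of_notMem_range _ _ hp] at h1 h2
    exact (hρ.adj t p).elim (fun h => h h1) fun h => h h2
  choose π hπ using hex
  have πinj : Function.Injective π := fun p q e => ho.1 (by rw [← hπ p, e, hπ q])
  have πpre : ∀ p, ρ.L.pre t (π p) = ρ.L.pre t p := by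
    intro p
    have h1 := DFunLike.congr_fun hpre (onP o p)
    rw [Finsupp.mapDomain_apply ho.1, ← hπ, Finsupp.mapDomain_apply hc.1.1] at h1
    exact h1.symm
  have πpost : ∀ p, ρ.L.post t (π p) = ρ.L.post t p := by
    intro p
    have h1 := DFunLike.congr_fun hpost (onP o p)
    rw [Finsupp.mapDomain_apply ho.1, ← hπ, Finsupp.mapDomain_apply hc.1.1] at h1
    exact h1.symm
  have πpl : ∀ p, ρ.L.pl (π p) ≤ ρ.L.pl p := by
    intro p
    rw [← hc.2.2.1, hπ]
    exact o.pl_le p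
  have πmrk : ∀ p, ρ.L.mrk p ≤ ρ.L.mrk (π p) := by
    intro p
    rw [hc.2.2.2 (π p), hπ]
    exact o.mrk_le p
  have itpl : ∀ n p, ρ.L.pl (π^[n] p) ≤ ρ.L.pl p := by
    intro n
    induction n with
    | zero => exact fun p => le_rfl
    | succ n ih => exact fun p => (ih (π p)).trans (πpl p)
  have itmrk : ∀ n p, ρ.L.mrk p ≤ ρ.L.mrk (π^[n] p) := by
    intro n
    induction n with
    | zero => exact fun p => le_rfl
    | succ n ih => exact fun p => (πmrk p).trans (ih (π p))
  -- On a finite set `π` is periodic, so `p` is an iterate of `π p`. The inequalities for labels and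
  -- markings thus also hold in reverse, and `distinct` applies.
  have πid : ∀ p, π p = p := by
    intro p
    obtain ⟨n, hn, hp⟩ := πinj.mem_periodicPts p
    obtain ⟨n, rfl⟩ := Nat.exists_eq_succ_of_ne_zero hn.ne'
    have hp' : π^[n] (π p) = p := hp
    refine hρ.distinct t _ _ (le_antisymm (πpl p) ?_) (le_antisymm ?_ (πmrk p)) (πpre p) (πpost p)
    · simpa only [hp'] using itpl n (π p)
    · simpa only [hp'] using itmrk n (π p)
  exact Net.hom_ext (fun p => by rw [← hπ, πid])
    fun x => by rw [hρ.subsingleton.elim x t, h]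

end Removal

/-! ### Commutation of independent substitutions -/

section Confluence

variable {AP : Type v} {AT : Type w} [PartialOrder AP] [PartialOrder AT]

/-- Cancellation in the pasting law for pushouts. -/
theorem exists_isPushout_of_comp {C : Type*} [Category C] {K A B D X Y : C} {f : K ⟶ A}
    {k : K ⟶ B} {i : A ⟶ X} {j : B ⟶ X} {q : B ⟶ D} {n : A ⟶ Y} {e : D ⟶ Y}
    (h : IsPushout f k i j) (h' : IsPushout f (k ≫ q) n e) :
    ∃ m : X ⟶ Y, IsPushout q j e m := by
  refine ⟨h.desc n (q ≫ e) (by rw [h'.w, Category.assoc]), ?_⟩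
  refine (IsPushout.of_top (h₁₁ := f) (v₁₁ := k) (v₁₂ := i) ?_ ?_ h).flip
  · rw [h.inl_desc]
    exact h'
  · rw [h.inr_desc]

/-- Substitutions at different transitions commute. -/
theorem Rule.IsSubst.diamond {ρ₁ ρ₂ : Rule.{u} AP AT} (hρ₁ : ρ₁.IsSubst) (hρ₂ : ρ₂.IsSubst)
    {M M₁ M₂ : Net.{u} AP AT} {o₁ : ρ₁.L ⟶ M} {o₂ : ρ₂.L ⟶ M} (i₁ : Inj o₁) (i₂ : Inj o₂)
    (h₁ : ρ₁.StepAt o₁ M₁) (h₂ : ρ₂.StepAt o₂ M₂) (hne : ∀ t₁ t₂, onT o₁ t₁ ≠ onT o₂ t₂) :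
    ∃ X, (∃ o : ρ₂.L ⟶ M₁, Inj o ∧ ρ₂.StepAt o X) ∧ ∃ o : ρ₁.L ⟶ M₂, Inj o ∧ ρ₁.StepAt o X := by
  obtain ⟨t₁⟩ := hρ₁.nonempty
  obtain ⟨t₂⟩ := hρ₂.nonempty
  obtain ⟨D₁, k₁, d₁, n₁, e₁, p₁, g₁⟩ := h₁
  obtain ⟨D₂, k₂, d₂, n₂, e₂, p₂, g₂⟩ := h₂
  have r₁ := hρ₁.isRemoval p₁ t₁
  have r₂ := hρ₂.isRemoval p₂ t₂
  obtain ⟨o₂', ho₂⟩ := r₁.exists_lift o₂ fun t => (hne t₁ t).symm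
  obtain ⟨o₁', ho₁⟩ := r₂.exists_lift o₁ fun t => hne t t₂
  have ho₁T : ∀ t, onT d₂ (onT o₁' t) = onT o₁ t := Net.congr_onT ho₁
  have ho₂T : ∀ t, onT d₁ (onT o₂' t) = onT o₂ t := Net.congr_onT ho₂
  -- `E` is `M` without both transitions, embedded in `D₁` and, by `s₂` below, in `D₂`.
  obtain ⟨E, q₁, s₁⟩ := exists_isRemoval D₁ (onT o₂' t₂)
  obtain ⟨q₂, hq⟩ := r₂.exists_lift (q₁ ≫ d₁) fun x e => (s₁.range _).1 ⟨x, rfl⟩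
    (r₁.strict.1.2 (by rw [ho₂T]; exact e))
  have hqP : ∀ p, onP d₂ (onP q₂ p) = onP d₁ (onP q₁ p) := Net.congr_onP hq
  have hqT : ∀ p, onT d₂ (onT q₂ p) = onT d₁ (onT q₁ p) := Net.congr_onT hq
  have s₂ : IsRemoval (onT o₁' t₁) q₂ := by
    refine ⟨.of_comp (hq ▸ s₁.strict.comp r₁.strict) r₂.strict,
      fun p => ?_, fun x => ⟨?_, fun hx => ?_⟩⟩
    · obtain ⟨a, ha⟩ := r₁.surj (onP d₂ p)
      obtain ⟨b, rfl⟩ := s₁.surj a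
      exact ⟨b, r₂.strict.1.1 (by rw [hqP, ha])⟩
    · rintro ⟨y, rfl⟩ e
      refine (r₁.range _).1 ⟨onT q₁ y, rfl⟩ ?_
      rw [← hqT, e, ho₁T]
    · obtain ⟨a, ha⟩ := (r₁.range (onT d₂ x)).2 fun e => hx (r₂.strict.1.2 (by rw [e, ho₁T]))
      obtain ⟨b, rfl⟩ := (s₁.range a).2 fun e => (r₂.range _).1 ⟨x, rfl⟩ (by rw [← ha, e, ho₂T])
      exact ⟨b, r₂.strict.1.2 (by rw [hqT, ha])⟩
  obtain ⟨k₂', hk₂⟩ := s₁.exists_lift (ρ₂.l ≫ o₂') hρ₂.isEmpty_K.elim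
  obtain ⟨k₁', hk₁⟩ := s₁.exists_lift k₁ hρ₁.isEmpty_K.elim
  have hk₁' : k₁' ≫ q₂ = ρ₁.l ≫ o₁' := by
    apply r₂.strict.1.cancel
    rw [Category.assoc, hq, ← Category.assoc, hk₁, ← p₁.w, Category.assoc, ho₁]
  have hk₂' : k₂' ≫ q₂ = k₂ := by
    apply r₂.strict.1.cancel
    rw [Category.assoc, hq, ← Category.assoc, hk₂, ← p₂.w, Category.assoc, ho₂]
  have a₂ : IsPushout ρ₂.l k₂' o₂' q₁ := hρ₂.isPushout_of_isRemoval hk₂.symm t₂ s₁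
    (by rw [← r₁.strict.2.1, ho₂T, hρ₂.tl_eq p₂])
  have a₁ : IsPushout ρ₁.l k₁' o₁' q₂ := hρ₁.isPushout_of_isRemoval hk₁'.symm t₁ s₂
    (by rw [← r₂.strict.2.1, ho₁T, hρ₁.tl_eq p₁])
  obtain ⟨E₁, i₁', j₁, b₁⟩ := exists_isGluing hρ₁.isEmpty_K ρ₁.r_strict k₁'
  obtain ⟨E₂, i₂', j₂, b₂⟩ := exists_isGluing hρ₂.isEmpty_K ρ₂.r_strict k₂'
  obtain ⟨m₁, c₁⟩ := exists_isPushout_of_comp b₁.isPushout (hk₁.symm ▸ g₁)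
  obtain ⟨m₂, c₂⟩ := exists_isPushout_of_comp b₂.isPushout (hk₂'.symm ▸ g₂)
  -- `X` is `E` with both right sides glued in. Pasting the squares over `E` exhibits it as the
  -- result of either order.
  obtain ⟨X, x, y, hX⟩ := exists_isGluing hρ₂.isEmpty_K ρ₂.r_strict (k₂' ≫ j₁)
  obtain ⟨z, hz⟩ := exists_isPushout_of_comp b₂.isPushout hX.isPushout
  have e₁s := (IsGluing.of_isPushout g₁ hρ₁.isEmpty_K ρ₁.r_strict).strict_right
  have e₂s := (IsGluing.of_isPushout g₂ hρ₂.isEmpty_K ρ₂.r_strict).strict_right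
  have io₁ : Inj o₁' := by
    rw [← ho₁] at i₁
    exact i₁.of_comp
  have io₂ : Inj o₂' := by
    rw [← ho₂] at i₂
    exact i₂.of_comp
  exact ⟨X, ⟨o₂' ≫ e₁, ⟨e₁s.1.1.comp io₂.1, e₁s.1.2.comp io₂.2⟩,
      E₁, k₂' ≫ j₁, m₁, x, y, a₂.paste_vert c₁, hX.isPushout⟩,
    ⟨o₁' ≫ e₂, ⟨e₂s.1.1.comp io₁.1, e₂s.1.2.comp io₁.2⟩,
      E₂, k₁' ≫ j₂, m₂, i₁' ≫ y, z, a₁.paste_vert c₂, b₁.isPushout.paste_vert hz⟩⟩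

end Confluence

/-! ### Abstract systems of uniquely named substitution rules -/

section System

variable {AP : Type v} {AT : Type w} [PartialOrder AP] [PartialOrder AT]

/-- The names of the transitions replaced by the rules of `SR`. -/
def ruleNames (SR : Set (Rule.{u} AP AT)) : Set AT :=
  {a | ∃ ρ ∈ SR, ∃ t : ρ.L.T, ρ.L.tl t = a}

/-- `desc a` is thought of as the set of the names that may be replaced when a transition named `a`
is expanded. In a separated net these sets are disjoint for different transitions, and every
transition with the name of a rule is a strict occurrence of this rule. -/
structure Separated (SR : Set (Rule.{u} AP AT)) (desc : AT → Set AT) (M : Net.{u} AP AT) :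
    Prop where
  disj : ∀ x y, x ≠ y → Disjoint (desc (M.tl x)) (desc (M.tl y))
  occ : ∀ ρ ∈ SR, ∀ (t : ρ.L.T) (x : M.T), M.tl x = ρ.L.tl t →
    ∃ c : ρ.L ⟶ M, Strict c ∧ onT c t = x

/-- A system of substitution rules with different names in which every name can be expanded only
once. -/
structure IsSystem (SR : Set (Rule.{u} AP AT)) (desc : AT → Set AT) : Prop where
  isSubst : ∀ ρ ∈ SR, ρ.IsSubst
  name_inj : ∀ ρ ∈ SR, ∀ ρ' ∈ SR, ∀ (t : ρ.L.T) (t' : ρ'.L.T), ρ.L.tl t = ρ'.L.tl t' → ρ = ρ'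
  desc_subset : ∀ a, desc a ⊆ ruleNames SR
  self_mem : ∀ ρ ∈ SR, ∀ t : ρ.L.T, ρ.L.tl t ∈ desc (ρ.L.tl t)
  desc_R : ∀ ρ ∈ SR, ∀ (t : ρ.L.T) (x : ρ.R.T),
    desc (ρ.R.tl x) ⊆ desc (ρ.L.tl t) \ {ρ.L.tl t}
  separated_R : ∀ ρ ∈ SR, Separated SR desc ρ.R

variable {SR : Set (Rule.{u} AP AT)} {desc : AT → Set AT} {M M' : Net.{u} AP AT}

theorem Separated.of_iso (h : Separated SR desc M) (φ : M ≅ M') : Separated SR desc M' := by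
  have hs := Net.iso_strict φ
  have hs' := Net.iso_strict φ.symm
  refine ⟨fun x y hxy => ?_, fun ρ hρ t x hx => ?_⟩
  · rw [← hs'.2.1 x, ← hs'.2.1 y]
    exact h.disj _ _ fun e => hxy (hs'.1.2 e)
  · rw [← hs'.2.1 x] at hx
    obtain ⟨c, hc, hct⟩ := h.occ ρ hρ t _ hx
    refine ⟨c ≫ φ.hom, hc.comp hs, ?_⟩
    rw [Net.comp_onT, hct]
    exact Net.iso_hom_inv_onT φ.symm x

theorem Step.of_iso (h : Step SR M M') {N : Net.{u} AP AT} (φ : M ≅ N) : Step SR N M' := by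
  obtain ⟨ρ, hρ, o, ho, D, k, d, n, e, p, q⟩ := h
  have hs := Net.iso_strict φ
  exact ⟨ρ, hρ, o ≫ φ.hom, ⟨hs.1.1.comp ho.1, hs.1.2.comp ho.2⟩, D, k, d ≫ φ.hom, n, e,
    p.of_iso (Iso.refl _) (Iso.refl _) (Iso.refl _) φ (by simp) (by simp) (by simp) (by simp), q⟩

theorem IsSystem.eq_of_tl_eq (hS : IsSystem SR desc) (h : Separated SR desc M)
    {ρ : Rule.{u} AP AT} (hρ : ρ ∈ SR) (t : ρ.L.T) {x y : M.T} (hx : M.tl x = ρ.L.tl t)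
    (hy : M.tl y = ρ.L.tl t) : x = y := by
  by_contra hxy
  have hd := h.disj x y hxy
  rw [hx, hy] at hd
  exact Set.disjoint_left.1 hd (hS.self_mem ρ hρ t) (hS.self_mem ρ hρ t)

theorem IsSystem.occurrence_unique (hS : IsSystem SR desc) (h : Separated SR desc M)
    {ρ : Rule.{u} AP AT} (hρ : ρ ∈ SR) {o o' : ρ.L ⟶ M} (ho : Inj o) (ho' : Inj o')
    {N N' : Net.{u} AP AT} (hst : ρ.StepAt o N) (hst' : ρ.StepAt o' N') :
    Strict o ∧ o = o' := by
  have hsub := hS.isSubst ρ hρ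
  obtain ⟨t⟩ := hsub.nonempty
  obtain ⟨D, k, d, n, e, p, -⟩ := hst
  obtain ⟨D', k', d', n', e', p', -⟩ := hst'
  have htl := hsub.tl_eq p t
  obtain ⟨c, hc, hct⟩ := h.occ ρ hρ t _ htl
  have h₁ := hsub.occurrence_unique hc ho t hct.symm
  have h₂ := hsub.occurrence_unique hc ho' t
    (hct.symm ▸ hS.eq_of_tl_eq h hρ t (hsub.tl_eq p' t) htl)
  exact ⟨h₁ ▸ hc, h₁.trans h₂.symm⟩

/-- New transitions have `desc` sets inside that of the replaced one, hence disjoint from those of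
the old transitions. An occurrence at an old transition avoids the replaced one, so it lifts to the
complement and survives. -/
theorem IsSystem.separated_step (hS : IsSystem SR desc) (h : Separated SR desc M)
    (hst : Step SR M M') : Separated SR desc M' := by
  obtain ⟨ρ, hρ, o, ho, hst⟩ := hst
  have hsub := hS.isSubst ρ hρ
  have hos := (hS.occurrence_unique h hρ ho ho hst hst).1
  obtain ⟨t⟩ := hsub.nonempty
  obtain ⟨D, k, d, n, e, p, q⟩ := hst
  have hd := hsub.isRemoval p t
  have hg := IsGluing.of_isPushout q hsub.isEmpty_K ρ.r_strict
  have hn : Strict n := hg.strict_left ρ.r_strict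
    (.of_comp (p.w ▸ ρ.l_strict.comp hos) hd.strict)
  have hne : ∀ b, onT d b ≠ onT o t := fun b => (hd.range _).1 ⟨b, rfl⟩
  have hcross : ∀ a b, Disjoint (desc (ρ.R.tl a)) (desc (D.tl b)) := by
    intro a b
    refine Set.disjoint_of_subset_left ((hS.desc_R ρ hρ t a).trans Set.sdiff_subset) ?_
    rw [← hsub.tl_eq p t, ← hd.strict.2.1]
    exact h.disj _ _ (hne b).symm
  refine ⟨fun x y hxy => ?_, fun ρ' hρ' t' x hx => ?_⟩
  · rcases hg.cover_T x with ⟨a, rfl⟩ | ⟨a, rfl⟩ <;> rcases hg.cover_T y with ⟨b, rfl⟩ | ⟨b, rfl⟩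
    · rw [hg.tl_left, hg.tl_left]
      exact (hS.separated_R ρ hρ).disj a b fun e => hxy (by rw [e])
    · rw [hg.tl_left, hg.tl_right]
      exact hcross a b
    · rw [hg.tl_left, hg.tl_right]
      exact (hcross b a).symm
    · rw [hg.tl_right, hg.tl_right, ← hd.strict.2.1, ← hd.strict.2.1]
      exact h.disj _ _ fun e => hxy (by rw [hd.strict.1.2 e])
  · rcases hg.cover_T x with ⟨a, rfl⟩ | ⟨a, rfl⟩
    · rw [hg.tl_left] at hx
      obtain ⟨c, hc, rfl⟩ := (hS.separated_R ρ hρ).occ ρ' hρ' t' a hx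
      exact ⟨c ≫ n, hc.comp hn, rfl⟩
    · rw [hg.tl_right, ← hd.strict.2.1] at hx
      obtain ⟨c, hc, hct⟩ := h.occ ρ' hρ' t' _ hx
      obtain ⟨c', rfl⟩ := hd.exists_lift c fun y => by
        rw [(hS.isSubst ρ' hρ').subsingleton.elim y t', hct]
        exact hne a
      exact ⟨c' ≫ e, (hc.of_comp hd.strict).comp hg.strict_right,
        congrArg (onT e) (hd.strict.1.2 hct)⟩

theorem IsSystem.separated_reach (hS : IsSystem SR desc) (h : Separated SR desc M)
    (hst : Relation.ReflTransGen (Step SR) M M') : Separated SR desc M' := by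
  induction hst with
  | refl => exact h
  | tail _ hs ih => exact hS.separated_step ih hs

/-- Steps or isomorphisms between separated nets. -/
def StepOrIso (SR : Set (Rule.{u} AP AT)) (desc : AT → Set AT) (M M' : Net.{u} AP AT) : Prop :=
  Separated SR desc M ∧ Separated SR desc M' ∧ (Step SR M M' ∨ Nonempty (M ≅ M'))

/-- Isomorphisms belong to the relation because two applications of one rule agree only up to
isomorphism. Different rules have different names, so they hit different transitions and commute. -/
theorem IsSystem.stepOrIso_diamond (hS : IsSystem SR desc) (M M₁ M₂ : Net.{u} AP AT)
    (h₁ : StepOrIso SR desc M M₁) (h₂ : StepOrIso SR desc M M₂) :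
    ∃ X, Relation.ReflGen (StepOrIso SR desc) M₁ X ∧
      Relation.ReflTransGen (StepOrIso SR desc) M₂ X := by
  obtain ⟨hM, s₁, h₁⟩ := h₁
  obtain ⟨-, s₂, h₂⟩ := h₂
  rcases h₁ with h₁ | ⟨⟨φ₁⟩⟩
  · rcases h₂ with h₂ | ⟨⟨φ₂⟩⟩
    · obtain ⟨ρ₁, hρ₁, o₁, i₁, st₁⟩ := h₁
      obtain ⟨ρ₂, hρ₂, o₂, i₂, st₂⟩ := h₂
      by_cases hρ : ρ₁ = ρ₂
      · subst hρ
        obtain rfl := (hS.occurrence_unique hM hρ₁ i₁ i₂ st₁ st₂).2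
        obtain ⟨φ⟩ := (hS.isSubst ρ₁ hρ₁).stepAt_unique st₁ st₂
        exact ⟨M₂, .single ⟨s₁, s₂, .inr ⟨φ⟩⟩, .refl⟩
      · obtain ⟨X, ⟨o, ho, hX⟩, ⟨o', ho', hX'⟩⟩ :=
          (hS.isSubst ρ₁ hρ₁).diamond (hS.isSubst ρ₂ hρ₂) i₁ i₂ st₁ st₂ fun t₁ t₂ e => by
            obtain ⟨_, _, _, _, _, p₁, -⟩ := st₁
            obtain ⟨_, _, _, _, _, p₂, -⟩ := st₂
            refine hρ (hS.name_inj ρ₁ hρ₁ ρ₂ hρ₂ t₁ t₂ ?_)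
            rw [← (hS.isSubst ρ₁ hρ₁).tl_eq p₁, e, (hS.isSubst ρ₂ hρ₂).tl_eq p₂]
        have hs : Step SR M₁ X := ⟨ρ₂, hρ₂, o, ho, hX⟩
        have hs' : Step SR M₂ X := ⟨ρ₁, hρ₁, o', ho', hX'⟩
        have sX := hS.separated_step s₁ hs
        exact ⟨X, .single ⟨s₁, sX, .inl hs⟩, .single ⟨s₂, sX, .inl hs'⟩⟩
    · exact ⟨M₁, .refl, .single ⟨s₂, s₁, .inl (h₁.of_iso φ₂)⟩⟩
  · rcases h₂ with h₂ | ⟨⟨φ₂⟩⟩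
    · exact ⟨M₂, .single ⟨s₁, s₂, .inl (h₂.of_iso φ₁)⟩, .refl⟩
    · exact ⟨M₂, .single ⟨s₁, s₂, .inr ⟨φ₁.symm ≪≫ φ₂⟩⟩, .refl⟩

theorem IsSystem.stepOrIso_of_reach (hS : IsSystem SR desc) (h : Separated SR desc M)
    (hst : Relation.ReflTransGen (Step SR) M M') :
    Relation.ReflTransGen (StepOrIso SR desc) M M' := by
  induction hst with
  | refl => exact .refl
  | tail hr hs ih =>
    have := hS.separated_reach h hr
    exact ih.tail ⟨this, hS.separated_step this hs, .inl hs⟩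

theorem iso_of_stepOrIso_of_terminal (hM : ∀ X, ¬ Step SR M X)
    (h : Relation.ReflTransGen (StepOrIso SR desc) M M') : Nonempty (M ≅ M') := by
  induction h with
  | refl => exact ⟨Iso.refl _⟩
  | tail _ hs ih =>
    obtain ⟨φ⟩ := ih
    rcases hs.2.2 with hs | ⟨⟨ψ⟩⟩
    · exact (hM _ (hs.of_iso φ.symm)).elim
    · exact ⟨φ ≪≫ ψ⟩

theorem IsSystem.transUnit_unique (hS : IsSystem SR desc) (h : Separated SR desc M)
    {F F' : Net.{u} AP AT} (hF : TransUnit SR M F) (hF' : TransUnit SR M F') :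
    Nonempty (F ≅ F') := by
  obtain ⟨X, hX, hX'⟩ := Relation.church_rosser hS.stepOrIso_diamond
    (hS.stepOrIso_of_reach h hF.1) (hS.stepOrIso_of_reach h hF'.1)
  obtain ⟨φ⟩ := iso_of_stepOrIso_of_terminal hF.2 hX
  obtain ⟨ψ⟩ := iso_of_stepOrIso_of_terminal hF'.2 hX'
  exact ⟨φ ≪≫ ψ.symm⟩

/-- The names which may still be replaced in `M`. -/
def openNames (desc : AT → Set AT) (M : Net.{u} AP AT) : Set AT :=
  ⋃ x, desc (M.tl x)

/-- The name of the replaced transition disappears: `desc_R` keeps it out of the right side, and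
disjointness out of the remaining transitions. -/
theorem IsSystem.openNames_ssubset (hS : IsSystem SR desc) (h : Separated SR desc M)
    (hst : Step SR M M') : openNames desc M' ⊂ openNames desc M := by
  obtain ⟨ρ, hρ, o, ho, D, k, d, n, e, p, q⟩ := hst
  have hsub := hS.isSubst ρ hρ
  obtain ⟨t⟩ := hsub.nonempty
  have hd := hsub.isRemoval p t
  have hg := IsGluing.of_isPushout q hsub.isEmpty_K ρ.r_strict
  have htl := hsub.tl_eq p t
  have hmem : ρ.L.tl t ∈ openNames desc M :=
    Set.mem_iUnion.2 ⟨onT o t, htl.symm ▸ hS.self_mem ρ hρ t⟩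
  have hsubset : openNames desc M' ⊆ openNames desc M \ {ρ.L.tl t} := by
    refine Set.iUnion_subset fun x => ?_
    rcases hg.cover_T x with ⟨a, rfl⟩ | ⟨b, rfl⟩
    · rw [hg.tl_left]
      refine (hS.desc_R ρ hρ t a).trans (Set.sdiff_subset_sdiff_left ?_)
      rw [← htl]
      exact Set.subset_iUnion (fun x => desc (M.tl x)) _
    · rw [hg.tl_right, ← hd.strict.2.1]
      refine Set.subset_sdiff_singleton (Set.subset_iUnion (fun x => desc (M.tl x)) _) fun hm => ?_
      refine Set.disjoint_left.1 (h.disj _ _ ((hd.range _).1 ⟨b, rfl⟩)) hm ?_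
      rw [htl]
      exact hS.self_mem ρ hρ t
  exact (Set.ssubset_iff_of_subset (hsubset.trans Set.sdiff_subset)).2
    ⟨_, hmem, fun hm => (hsubset hm).2 rfl⟩

theorem IsSystem.ncard_openNames_lt (hS : IsSystem SR desc) (hfin : SR.Finite)
    (h : Separated SR desc M) (hst : Step SR M M') :
    (openNames desc M').ncard < (openNames desc M).ncard := by
  refine Set.ncard_lt_ncard (hS.openNames_ssubset h hst) ?_
  have hnames : (ruleNames SR).Finite := by
    refine (hfin.biUnion (t := fun ρ => Set.range ρ.L.tl) fun ρ hρ => ?_).subset ?_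
    · have := (hS.isSubst ρ hρ).subsingleton
      exact Set.finite_range _
    · rintro a ⟨ρ, hρ, t, rfl⟩
      exact Set.mem_biUnion hρ ⟨t, rfl⟩
  exact hnames.subset (Set.iUnion_subset fun x => hS.desc_subset _)

theorem IsSystem.no_infinite_run (hS : IsSystem SR desc) (hfin : SR.Finite)
    (h : Separated SR desc M) :
    ¬ ∃ S : ℕ → Net.{u} AP AT, S 0 = M ∧ ∀ i, Step SR (S i) (S (i + 1)) := by
  rintro ⟨S, rfl, hstep⟩
  have hsep : ∀ i, Separated SR desc (S i) := fun i => by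
    induction i with
    | zero => exact h
    | succ i ih => exact hS.separated_step ih (hstep i)
  have hle : ∀ i, (openNames desc (S i)).ncard + i ≤ (openNames desc (S 0)).ncard := fun i => by
    induction i with
    | zero => exact le_rfl
    | succ i ih =>
      have := hS.ncard_openNames_lt hfin (hsep i) (hstep i)
      omega
  have := hle ((openNames desc (S 0)).ncard + 1)
  omega

theorem IsSystem.exists_transUnit (hS : IsSystem SR desc) (hfin : SR.Finite)
    (h : Separated SR desc M) : ∃ F, TransUnit SR M F := by
  induction hn : (openNames desc M).ncard using Nat.strong_induction_on generalizing M with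
  | _ n ih =>
    by_cases hM : ∃ M', Step SR M M'
    · obtain ⟨M', hM'⟩ := hM
      obtain ⟨F, hF⟩ := ih _ (hn ▸ hS.ncard_openNames_lt hfin h hM') (hS.separated_step h hM') rfl
      exact ⟨F, hF.1.head hM', hF.2⟩
    · exact ⟨M, .refl, not_exists.1 hM⟩

end System

/-! ### Substitution rules of a hierarchy form a system -/

section Hierarchy

variable {AP : Type v} {AT : Type w} [PartialOrder AP] [PartialOrder AT]

theorem Net.mapDomain_subtypeDomain {P : Type u} {s : Set P} {m : P →₀ ℕ}
    (h : ∀ p, m p ≠ 0 → p ∈ s) :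
    (m.subtypeDomain (· ∈ s)).mapDomain (Subtype.val : s → P) = m := by
  ext p
  by_cases hp : p ∈ s
  · exact Finsupp.mapDomain_apply Subtype.val_injective _ (⟨p, hp⟩ : s)
  · rw [Finsupp.mapDomain_of_notMem_range _ _ (by simpa using hp)]
    by_contra hne
    exact hp (h p (Ne.symm hne))

/-- The inclusion of `Net(t)`. -/
noncomputable def Net.netOfIncl (N : Net.{u} AP AT) (t : N.T) : N.netOf t ⟶ N where
  onP := Subtype.val
  onT := Subtype.val
  pre_eq := by
    rintro ⟨s, rfl⟩
    exact (Net.mapDomain_subtypeDomain fun _ hp => Or.inl hp).symm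
  post_eq := by
    rintro ⟨s, rfl⟩
    exact (Net.mapDomain_subtypeDomain fun _ hp => Or.inr hp).symm
  pl_le _ := le_rfl
  tl_le _ := le_rfl
  mrk_le _ := le_rfl

theorem Net.netOfIncl_strict (N : Net.{u} AP AT) (t : N.T) : Strict (N.netOfIncl t) :=
  ⟨⟨Subtype.val_injective, Subtype.val_injective⟩, fun _ => rfl, fun _ => rfl, fun _ => rfl⟩

theorem Level.subst_isSubst {N : Net.{u} AP AT} (d : Level N) (t : d.sT) :
    (d.subst t).IsSubst where
  isEmpty_K := inferInstanceAs (IsEmpty PEmpty)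
  nonempty := ⟨⟨t.1, rfl⟩⟩
  subsingleton := ⟨fun x y => Subtype.ext (x.2.trans y.2.symm)⟩
  surj p := ⟨p, rfl⟩
  adj := by
    rintro ⟨s, rfl⟩ p
    exact p.2
  distinct := by
    rintro ⟨s, rfl⟩ p q h₁ h₂ h₃ h₄
    exact Subtype.ext (d.conn_distinct _ t.2 p.1 p.2 q.1 q.2 h₁ h₂ h₃ h₄)

theorem Level.subst_tl {N : Net.{u} AP AT} (d : Level N) (t : d.sT) (x : (d.subst t).L.T) :
    (d.subst t).L.tl x = N.tl t.1 :=
  congrArg N.tl x.2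

theorem Level.eq_of_tl_eq {N : Net.{u} AP AT} (d : Level N) {t : d.sT} {x : N.T}
    (h : N.tl x = N.tl t.1) : x = t.1 := by
  have hx : x ∈ d.sT := by
    by_contra hx
    exact d.tl_not_sub x hx (h ▸ d.tl_sub _ t.2)
  exact d.tl_inj hx t.2 h

theorem Level.exists_occurrence {N : Net.{u} AP AT} (d : Level N) (t : d.sT)
    (y : (d.subst t).L.T) {x : N.T} (h : N.tl x = (d.subst t).L.tl y) :
    ∃ c : (d.subst t).L ⟶ N, Strict c ∧ onT c y = x :=
  ⟨N.netOfIncl t.1, N.netOfIncl_strict t.1,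
    Eq.trans y.2 (d.eq_of_tl_eq (h.trans (d.subst_tl t y))).symm⟩

/-- The names that may be replaced, by the rules of all levels, when a transition named `b` is
expanded. -/
def SubstNet.desc : ∀ {N : Net.{u} AP AT}, SubstNet N → AT → Set AT
  | _, .mk N d sub => fun b =>
    {c | (∃ t : d.sT, N.tl t.1 = b ∧ (c = b ∨ c ∈ ruleNames (sub t).allRules)) ∨
      ∃ t, c ∈ (sub t).desc b}

theorem SubstNet.mem_allRules_mk {N : Net.{u} AP AT} {d : Level N}
    {sub : ∀ t : d.sT, SubstNet (d.SN t)} {ρ : Rule.{u} AP AT} :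
    ρ ∈ (SubstNet.mk N d sub).allRules ↔
      (∃ t, d.subst t = ρ) ∨ ∃ t, ρ ∈ (sub t).allRules := by
  rw [SubstNet.allRules, Set.mem_union, Set.mem_range, Set.mem_iUnion]

theorem SubstNet.ruleNames_subset {N : Net.{u} AP AT} (S : SubstNet N) :
    ruleNames S.allRules ⊆ S.allSubNames := by
  induction S with
  | mk N d sub ih =>
    rintro a ⟨ρ, hρ, x, rfl⟩
    rw [SubstNet.allSubNames]
    rcases SubstNet.mem_allRules_mk.1 hρ with ⟨t, rfl⟩ | ⟨t, ht⟩
    · rw [d.subst_tl]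
      exact Or.inl (d.tl_sub _ t.2)
    · exact Or.inr (Set.mem_iUnion.2 ⟨t, ih t ⟨ρ, ht, x, rfl⟩⟩)

theorem SubstNet.allSubNames_subset {N : Net.{u} AP AT} (S : SubstNet N) :
    S.allSubNames ⊆ S.allTransNames := by
  induction S with
  | mk N d sub ih =>
    rw [SubstNet.allSubNames, SubstNet.allTransNames]
    exact Set.union_subset_union d.subNames_subset (Set.iUnion_mono ih)

theorem SubstNet.tl_mem {N : Net.{u} AP AT} (S : SubstNet N) (x : N.T) :
    N.tl x ∈ S.allTransNames := by
  cases S with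
  | mk _ d sub =>
    rw [SubstNet.allTransNames]
    exact Or.inl (d.labels_over.2 x)

theorem SubstNet.tl_R_mem {N : Net.{u} AP AT} (S : SubstNet N) {ρ : Rule.{u} AP AT}
    (hρ : ρ ∈ S.allRules) (x : ρ.R.T) : ρ.R.tl x ∈ S.allTransNames := by
  induction S with
  | mk N d sub ih =>
    rw [SubstNet.allTransNames]
    rcases SubstNet.mem_allRules_mk.1 hρ with ⟨t, rfl⟩ | ⟨t, ht⟩
    · exact Or.inr (Set.mem_iUnion.2 ⟨t, (sub t).tl_mem x⟩)
    · exact Or.inr (Set.mem_iUnion.2 ⟨t, ih t ht⟩)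

theorem SubstNet.desc_subset {N : Net.{u} AP AT} (S : SubstNet N) (b : AT) :
    S.desc b ⊆ ruleNames S.allRules := by
  induction S with
  | mk N d sub ih =>
    have hsub : ∀ t, ruleNames (sub t).allRules ⊆ ruleNames (SubstNet.mk N d sub).allRules := by
      rintro t c ⟨ρ, hρ, y, rfl⟩
      exact ⟨ρ, SubstNet.mem_allRules_mk.2 (.inr ⟨t, hρ⟩), y, rfl⟩
    rw [SubstNet.desc]
    rintro c (⟨t, rfl, rfl | hc⟩ | ⟨t, hc⟩)
    · exact ⟨d.subst t, SubstNet.mem_allRules_mk.2 (.inl ⟨t, rfl⟩), ⟨t.1, rfl⟩, rfl⟩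
    · exact hsub t hc
    · exact hsub t (ih t hc)

theorem SubstNet.mem_allSubNames_of_mem_desc {N : Net.{u} AP AT} (S : SubstNet N) {b c : AT}
    (h : c ∈ S.desc b) : b ∈ S.allSubNames := by
  induction S with
  | mk N d sub ih =>
    rw [SubstNet.desc] at h
    rw [SubstNet.allSubNames]
    rcases h with ⟨t, rfl, -⟩ | ⟨t, hc⟩
    · exact Or.inl (d.tl_sub _ t.2)
    · exact Or.inr (Set.mem_iUnion.2 ⟨t, ih t hc⟩)

section Mk

variable {N : Net.{u} AP AT} {d : Level N} {sub : ∀ t : d.sT, SubstNet (d.SN t)}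

theorem SubstNet.WellNamed.index_eq (h : (SubstNet.mk N d sub).WellNamed) {t t' : d.sT} {b : AT}
    (hb : b ∈ (sub t).allSubNames) (hb' : b ∈ (sub t').allTransNames) : t = t' := by
  rw [SubstNet.WellNamed] at h
  by_contra hne
  exact Set.disjoint_left.1 (h.2.2.2.1 t t' hne) hb hb'

theorem SubstNet.WellNamed.notMem_allTransNames (h : (SubstNet.mk N d sub).WellNamed)
    (t t' : d.sT) : N.tl t.1 ∉ (sub t').allTransNames := by
  rw [SubstNet.WellNamed] at h
  exact Set.disjoint_left.1 (h.2.1 t') (d.tl_sub _ t.2)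

theorem SubstNet.WellNamed.notMem_allSubNames (h : (SubstNet.mk N d sub).WellNamed)
    (x : N.T) (t : d.sT) : N.tl x ∉ (sub t).allSubNames := by
  rw [SubstNet.WellNamed] at h
  exact Set.disjoint_left.1 (h.2.2.1 t) (d.labels_over.2 x)

/-- A name known inside one subnet is reserved neither on the top level nor in a sibling, so only
that subnet contributes. This carries the induction hypothesis from a subnet to the whole hierarchy.
-/
theorem SubstNet.WellNamed.desc_eq (h : (SubstNet.mk N d sub).WellNamed) {t : d.sT} {b : AT}
    (hb : b ∈ (sub t).allTransNames) : (SubstNet.mk N d sub).desc b = (sub t).desc b := by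
  rw [SubstNet.desc]
  ext c
  constructor
  · rintro (⟨t', rfl, -⟩ | ⟨t', hc⟩)
    · exact (h.notMem_allTransNames t' t hb).elim
    · obtain rfl := h.index_eq ((sub t').mem_allSubNames_of_mem_desc hc) hb
      exact hc
  · exact fun hc => .inr ⟨t, hc⟩

theorem SubstNet.WellNamed.mem_allRules (h : (SubstNet.mk N d sub).WellNamed) {t : d.sT}
    {ρ : Rule.{u} AP AT} (hρ : ρ ∈ (SubstNet.mk N d sub).allRules) {y : ρ.L.T}
    (hy : ρ.L.tl y ∈ (sub t).allTransNames) : ρ ∈ (sub t).allRules := by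
  rcases SubstNet.mem_allRules_mk.1 hρ with ⟨t', rfl⟩ | ⟨t', ht'⟩
  · rw [d.subst_tl] at hy
    exact (h.notMem_allTransNames t' t hy).elim
  · obtain rfl := h.index_eq ((sub t').ruleNames_subset ⟨ρ, ht', y, rfl⟩) hy
    exact ht'

theorem SubstNet.WellNamed.separated (h : (SubstNet.mk N d sub).WellNamed) {t : d.sT}
    {M : Net.{u} AP AT} (hM : ∀ x, M.tl x ∈ (sub t).allTransNames)
    (hs : Separated (sub t).allRules (sub t).desc M) :
    Separated (SubstNet.mk N d sub).allRules (SubstNet.mk N d sub).desc M where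
  disj x y hxy := by
    rw [h.desc_eq (hM x), h.desc_eq (hM y)]
    exact hs.disj x y hxy
  occ ρ hρ y x hx := hs.occ ρ (h.mem_allRules hρ (hx ▸ hM x)) y x hx

theorem SubstNet.WellNamed.mem_desc_tl (h : (SubstNet.mk N d sub).WellNamed) {x : N.T} {c : AT}
    (hc : c ∈ (SubstNet.mk N d sub).desc (N.tl x)) :
    ∃ hx : x ∈ d.sT, c = N.tl x ∨ c ∈ (sub ⟨x, hx⟩).allSubNames := by
  rw [SubstNet.desc] at hc
  rcases hc with ⟨t, ht, hc⟩ | ⟨t, hc⟩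
  · obtain rfl := d.eq_of_tl_eq ht.symm
    exact ⟨t.2, hc.imp_right fun hc => (sub t).ruleNames_subset hc⟩
  · exact (h.notMem_allSubNames x t ((sub t).mem_allSubNames_of_mem_desc hc)).elim

theorem SubstNet.WellNamed.separated_mk (h : (SubstNet.mk N d sub).WellNamed) :
    Separated (SubstNet.mk N d sub).allRules (SubstNet.mk N d sub).desc N where
  disj x y hxy := by
    refine Set.disjoint_left.2 fun c hc hc' => ?_
    obtain ⟨hx, hc⟩ := h.mem_desc_tl hc
    obtain ⟨hy, hc'⟩ := h.mem_desc_tl hc'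
    rcases hc with rfl | hc
    · rcases hc' with hc' | hc'
      · exact hxy (d.tl_inj hx hy hc')
      · exact h.notMem_allSubNames _ _ hc'
    · rcases hc' with rfl | hc'
      · exact h.notMem_allSubNames _ _ hc
      · exact hxy (congrArg Subtype.val (h.index_eq hc (SubstNet.allSubNames_subset _ hc')))
  occ ρ hρ y x hx := by
    rcases SubstNet.mem_allRules_mk.1 hρ with ⟨t, rfl⟩ | ⟨t, ht⟩
    · exact d.exists_occurrence t y hx
    · exact (h.notMem_allSubNames x t (hx ▸ (sub t).ruleNames_subset ⟨ρ, ht, y, rfl⟩)).elim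

end Mk

/-- Induction on the nesting. The rule of a top transition has the subnet itself as right side, so
its `Separated` condition is the second half of the induction hypothesis; this is why both halves
are proved together. -/
theorem SubstNet.isSystem_allRules {N : Net.{u} AP AT} (S : SubstNet N) (h : S.WellNamed) :
    IsSystem S.allRules S.desc ∧ Separated S.allRules S.desc N := by
  induction S with
  | mk N d sub ih =>
    have hsub : ∀ t, (sub t).WellNamed := by
      have h' := h
      rw [SubstNet.WellNamed] at h'
      exact h'.2.2.2.2
    replace ih := fun t => ih t (hsub t)
    refine ⟨⟨fun ρ hρ => ?_, fun ρ hρ ρ' hρ' y y' e => ?_, SubstNet.desc_subset _,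
      fun ρ hρ y => ?_, fun ρ hρ y x => ?_, fun ρ hρ => ?_⟩, h.separated_mk⟩
    · rcases SubstNet.mem_allRules_mk.1 hρ with ⟨t, rfl⟩ | ⟨t, ht⟩
      · exact d.subst_isSubst t
      · exact (ih t).1.isSubst ρ ht
    · rcases SubstNet.mem_allRules_mk.1 hρ with ⟨t, rfl⟩ | ⟨t, ht⟩
      · rcases SubstNet.mem_allRules_mk.1 hρ' with ⟨t', rfl⟩ | ⟨t', ht'⟩
        · rw [d.subst_tl, d.subst_tl] at e
          rw [Subtype.ext (d.tl_inj t.2 t'.2 e)]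
        · rw [d.subst_tl] at e
          exact (h.notMem_allSubNames _ t'
            (e ▸ (sub t').ruleNames_subset ⟨ρ', ht', y', rfl⟩)).elim
      · have hy : ρ.L.tl y ∈ (sub t).allTransNames :=
          (sub t).allSubNames_subset ((sub t).ruleNames_subset ⟨ρ, ht, y, rfl⟩)
        exact (ih t).1.name_inj ρ ht ρ' (h.mem_allRules hρ' (e ▸ hy)) y y' e
    · rw [SubstNet.desc]
      rcases SubstNet.mem_allRules_mk.1 hρ with ⟨t, rfl⟩ | ⟨t, ht⟩
      · exact .inl ⟨t, (d.subst_tl t y).symm, .inl rfl⟩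
      · exact .inr ⟨t, (ih t).1.self_mem ρ ht y⟩
    · rcases SubstNet.mem_allRules_mk.1 hρ with ⟨t, rfl⟩ | ⟨t, ht⟩
      · rw [h.desc_eq (t := t) (b := (d.subst t).R.tl x) ((sub t).tl_mem x), d.subst_tl,
          SubstNet.desc]
        intro c hc
        have hc' := (sub t).desc_subset _ hc
        refine ⟨.inl ⟨t, rfl, .inr hc'⟩, fun e => ?_⟩
        rw [Set.mem_singleton_iff.1 e] at hc'
        exact h.notMem_allSubNames _ t ((sub t).ruleNames_subset hc')
      · rw [h.desc_eq ((sub t).tl_R_mem ht x), h.desc_eq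
          ((sub t).allSubNames_subset ((sub t).ruleNames_subset ⟨ρ, ht, y, rfl⟩))]
        exact (ih t).1.desc_R ρ ht y x
    · rcases SubstNet.mem_allRules_mk.1 hρ with ⟨t, rfl⟩ | ⟨t, ht⟩
      · exact h.separated (sub t).tl_mem (ih t).2
      · exact h.separated ((sub t).tl_R_mem ht) ((ih t).1.separated_R ρ ht)

/-- No transition of a subnet carries a reserved name of the main net, so the right sides have empty
`desc` sets and each name only replaces itself. -/
theorem SubstNet.isSystem_topRules {N : Net.{u} AP AT} (S : SubstNet N) (h : S.WellNamed) :
    IsSystem S.topRules (fun b => {b} ∩ ruleNames S.topRules) ∧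
      Separated S.topRules (fun b => {b} ∩ ruleNames S.topRules) N := by
  cases S with
  | mk _ d sub =>
    rw [SubstNet.topRules]
    have hR : ∀ (t : d.sT) (x : (d.subst t).R.T),
        (d.subst t).R.tl x ∉ ruleNames (Set.range d.subst) := by
      rintro t x ⟨_, ⟨t', rfl⟩, y, hy⟩
      rw [d.subst_tl] at hy
      exact h.notMem_allTransNames t' t (hy ▸ (sub t).tl_mem x)
    have hne : ∀ (t : d.sT) (x : (d.subst t).R.T),
        {(d.subst t).R.tl x} ∩ ruleNames (Set.range d.subst) = ∅ := fun t x =>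
      Set.singleton_inter_eq_empty.2 (hR t x)
    refine ⟨⟨?_, ?_, fun b => Set.inter_subset_right, ?_, ?_, ?_⟩, ⟨fun x y hxy => ?_, ?_⟩⟩
    · rintro _ ⟨t, rfl⟩
      exact d.subst_isSubst t
    · rintro _ ⟨t, rfl⟩ _ ⟨t', rfl⟩ y y' e
      rw [d.subst_tl, d.subst_tl] at e
      rw [Subtype.ext (d.tl_inj t.2 t'.2 e)]
    · exact fun ρ hρ y => ⟨rfl, ρ, hρ, y, rfl⟩
    · rintro _ ⟨t, rfl⟩ y x
      rw [hne]
      exact Set.empty_subset _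
    · rintro _ ⟨t, rfl⟩
      refine ⟨fun x y _ => ?_, fun ρ hρ y x hx => (hR t x ⟨ρ, hρ, y, hx.symm⟩).elim⟩
      rw [hne]
      exact Set.empty_disjoint _
    · refine Set.disjoint_left.2 ?_
      rintro c ⟨rfl, _, ⟨t, rfl⟩, z, hz⟩ ⟨hc, -⟩
      rw [d.subst_tl] at hz
      exact hxy ((d.eq_of_tl_eq hz.symm).trans (d.eq_of_tl_eq (hc.symm.trans hz.symm)).symm)
    · rintro _ ⟨t, rfl⟩ y x hx
      exact d.exists_occurrence t y hx

end Hierarchy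

end HPN

/-- The substitution rules `SR` of a hierarchical net `HN` (those of the main net only, or those of
all levels), applied as long as possible with injective occurrences in any order, produce a net that
is unique up to isomorphism; if there are finitely many of them, then every run ends and such a net
exists. -/
theorem mainTheorem5 {AP : Type v} {AT : Type w} [PartialOrder AP] [OrderTop AP]
    [PartialOrder AT] [OrderTop AT] (HN : HPN.HierNet.{u} AP AT)
    (SR : Set (HPN.Rule.{u} AP AT))
    (hSR : SR = HN.subs.topRules ∨ SR = HN.subs.allRules) :
    (∀ F F' : HPN.Net.{u} AP AT,
      HPN.TransUnit SR HN.net F → HPN.TransUnit SR HN.net F' → Nonempty (F ≅ F')) ∧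
    (SR.Finite →
      (¬ ∃ M : ℕ → HPN.Net.{u} AP AT, M 0 = HN.net ∧ ∀ i, HPN.Step SR (M i) (M (i + 1))) ∧
      ∃ F : HPN.Net.{u} AP AT, HPN.TransUnit SR HN.net F) := by
  obtain ⟨desc, hS, hN⟩ : ∃ desc, HPN.IsSystem SR desc ∧ HPN.Separated SR desc HN.net := by
    rcases hSR with rfl | rfl
    · exact ⟨_, HN.subs.isSystem_topRules HN.wellNamed⟩
    · exact ⟨_, HN.subs.isSystem_allRules HN.wellNamed⟩
  exact ⟨fun F F' hF hF' => hS.transUnit_unique hN hF hF', fun hfin =>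
    ⟨hS.no_infinite_run hfin hN, hS.exists_transUnit hfin hN⟩⟩
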